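/- Let $T$ be a nonempty finite set of subgraph types; type $t\in T$ is given by a simple undirected graph $H_t$ on the vertex set $\{1,\dots,m_t\}$. Let $n\ge 1$. For $t\in T$ and an ordered list $L=[v_1,\dots,v_{m_t}]$ of $m_t$ distinct nodes of $\{1,\dots,n\}$, let $g_t(L)$ be the copy of $H_t$ in which vertex $k$ is placed on node $v_k$. Let $p(t,L)\in[0,1]$ be given for all such pairs $(t,L)$. In the weighted subgraph generated model $\mathrm{wSUGM}(n,T,p)$ the subgraphs $g_t(L)$ are formed independently, $g_t(L)$ with probability $p(t,L)$, and the adjacency matrix $A_w\in\mathbb N^{n\times n}$ has as $(i,j)$ entry the total number of formed subgraphs (pairs $(t,L)$) that contain the edge $\{i,j\}$. Let $\Delta_w:=\|\mathbb E A_w\|_\infty$ be the maximum expected degree (the largest absolute row sum of $\mathbb E A_w$), and let $M:=\max_{t\in T} m_t$. Let $\epsilon>0$ and suppose that $$\Delta_w>\tfrac49\ln(2n/\epsilon).$$ Then, with probability at least $1-\epsilon$, $$\|A_w-\mathbb E A_w\|_2\le\sqrt{4M^2\Delta_w\ln(2n/\epsilon)},$$ where $\|\cdot\|_2$ is the spectral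 norm. -/

import Mathlib

open MeasureTheory ProbabilityTheory

namespace SUGM

/-- The possible subgraphs of a model of size `n` whose subgraph type `t` has `m t` nodes: a type `t`
together with an ordered list `L` of `m t` distinct nodes among the `n` nodes. -/
abbrev Placement {T : Type*} (m : T → ℕ) (n : ℕ) : Type _ :=
  (t : T) × (Fin (m t) ↪ Fin n)

/-- The subgraph `g_t(L)` of type `t` generated on the list `L`: the pattern `H t` carried over to the
`n` nodes, its `k`-th vertex being put on the `k`-th node of `L`. -/
def placedGraph {T : Type*} {m : T → ℕ} (H : ∀ t, SimpleGraph (Fin (m t))) {n : ℕ}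
    (s : Placement m n) : SimpleGraph (Fin n) :=
  (H s.1).map s.2

open Classical in
/-- The weighted adjacency matrix when exactly the subgraphs `s` with `x s = true` are formed: the
`(i, j)` entry is the number of formed subgraphs that contain the edge `(i, j)`. -/
noncomputable def weightedAdj {T : Type*} [Fintype T] {m : T → ℕ}
    (H : ∀ t, SimpleGraph (Fin (m t))) {n : ℕ} (x : Placement m n → Bool) :
    Matrix (Fin n) (Fin n) ℕ :=
  Matrix.of fun i j =>
    (Finset.univ.filter fun s : Placement m n => x s = true ∧ (placedGraph H s).Adj i j).card

/-- The formation process: `x s` tells whether the possible subgraph `s` is formed; the subgraphs are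
formed independently, `s = (t, L)` with probability `p s`. -/
structure IsFormation {T : Type*} {m : T → ℕ} {n : ℕ} {Ω : Type*} [MeasurableSpace Ω]
    (P : Measure Ω) (p : Placement m n → unitInterval) (x : Placement m n → Ω → Bool) : Prop where
  measurable : ∀ s, Measurable (x s)
  indep : iIndepFun x P
  prob : ∀ s, P.real {ω | x s ω = true} = p s

/-- The random adjacency matrix `A_w` of the weighted model, as a real matrix. -/
noncomputable def Aw {T : Type*} [Fintype T] {m : T → ℕ} (H : ∀ t, SimpleGraph (Fin (m t)))
    {n : ℕ} {Ω : Type*} (x : Placement m n → Ω → Bool) (ω : Ω) : Matrix (Fin n) (Fin n) ℝ :=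
  (weightedAdj H fun s => x s ω).map (Nat.cast : ℕ → ℝ)

/-- The entrywise expectation of a random matrix. -/
noncomputable def expect {n : ℕ} {Ω : Type*} [MeasurableSpace Ω] (P : Measure Ω)
    (A : Ω → Matrix (Fin n) (Fin n) ℝ) : Matrix (Fin n) (Fin n) ℝ :=
  Matrix.of fun i j => ∫ ω, A ω i j ∂P

open scoped Matrix.Norms.Operator in
/-- `‖B‖_∞`, the operator norm for the sup norm on vectors (the maximal absolute row sum). -/
noncomputable def normInf {n : ℕ} (B : Matrix (Fin n) (Fin n) ℝ) : ℝ := ‖B‖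

open scoped Matrix.Norms.L2Operator in
/-- `‖B‖_2`, the spectral norm (the operator norm for the Euclidean norm on vectors). -/
noncomputable def normTwo {n : ℕ} (B : Matrix (Fin n) (Fin n) ℝ) : ℝ := ‖B‖

/-- The maximum expected degree `Δ_w = ‖E A_w‖_∞`. -/
noncomputable def maxExpectedDegree {T : Type*} [Fintype T] {m : T → ℕ}
    (H : ∀ t, SimpleGraph (Fin (m t))) {n : ℕ} {Ω : Type*} [MeasurableSpace Ω] (P : Measure Ω)
    (x : Placement m n → Ω → Bool) : ℝ :=
  normInf (expect P (Aw H x))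

/-- The maximal subgraph size `M = max_t m_t`. -/
def maxSize {T : Type*} [Fintype T] (m : T → ℕ) : ℕ := Finset.univ.sup m

end SUGM

/-!
The centred matrix `A_w - 𝔼 A_w` is a sum of independent terms `(b_s - p_s) A_s`, where `A_s` is the
fixed adjacency matrix of the placed subgraph `s` and `b_s` is a Bernoulli variable. The deviation
bound is a matrix Bernstein inequality for such sums, and their special form makes Lieb's concavity
theorem unnecessary. Indeed `(b_s - p_s) A_s` commutes with `A_s ^ 2`, so that
`𝔼 exp (θ (b_s - p_s) A_s - θ² p_s A_s ^ 2) ≤ 1` in the positive semidefinite order follows from the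
scalar inequality `exp u ≤ 1 + u + u ^ 2` for `u ≤ 3 / 2`, applied to the eigenvalues of `A_s`.
Subtracting the variance inside the exponential lets the Golden–Thompson inequality
(`trace_exp_add_le`) remove the summands one at a time (`trace_exp_compensated_le`), which gives
`𝔼 tr exp (θ (A_w - 𝔼 A_w) - θ² V) ≤ n` with `V = ∑ p_s A_s ^ 2` (`integral_trace_exp_sum_le`). The
bound thus involves the norm of the sum `V` and not the much larger sum of the norms.

All rows of `A_s` have sum at most `M`. Hence `A_s` has eigenvalues at most `M` in absolute value, and
the row sums of `V` are at most `M Δ_w` (`dotProduct_variance_le`). Markov's inequality for the trace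
exponential with `θ = √(L / Δ_w) / M`, where `L = ln (2n / ε)`, bounds the probability that the largest
eigenvalue exceeds `a = √(4 M ^ 2 Δ_w L)` by `n exp (-L) = ε / 2`; the hypothesis on `Δ_w` is
`θ M < 3 / 2`. The same bound for the negated matrices controls the smallest eigenvalue.

Golden–Thompson itself is obtained from the Lie product formula (`tendsto_exp_mul_exp_pow`) and the
inequality `tr (P Q) ^ 2 ^ k ≤ tr (P ^ 2 ^ k Q ^ 2 ^ k)` for symmetric `P`, `Q`
(`trace_pow_two_pow_le`).
-/

namespace SUGM

open Matrix Filter Topology NormedSpace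

/-! ### Trace inequalities for powers of products -/

section Trace

variable {ι : Type*} [Fintype ι]

/-- Cauchy–Schwarz for the Frobenius inner product of `X` and `Yᵀ`, in arithmetic-mean form. -/
lemma trace_mul_le_half (X Y : Matrix ι ι ℝ) :
    2 * (X * Y).trace ≤ (X * Xᵀ).trace + (Y * Yᵀ).trace := by
  have h : 0 ≤ ((X - Yᵀ) * (X - Yᵀ)ᵀ).trace := by
    simp only [trace, diag_apply, mul_apply, transpose_apply]
    exact Finset.sum_nonneg fun i _ => Finset.sum_nonneg fun j _ => mul_self_nonneg _
  have e : ((X - Yᵀ) * (X - Yᵀ)ᵀ).trace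
      = (X * Xᵀ).trace + (Y * Yᵀ).trace - 2 * (X * Y).trace := by
    have h1 : (Yᵀ * Xᵀ).trace = (X * Y).trace := by rw [← transpose_mul, trace_transpose]
    simp only [transpose_sub, transpose_transpose, sub_mul, mul_sub, trace_sub, h1,
      trace_mul_comm Yᵀ Y]
    ring
  linarith

variable [DecidableEq ι]

lemma trace_mul_pow_comm (X Y : Matrix ι ι ℝ) (k : ℕ) :
    ((X * Y) ^ k).trace = ((Y * X) ^ k).trace := by
  cases k with
  | zero => simp
  | succ k =>
    have h : (X * Y) ^ (k + 1) = X * ((Y * X) ^ k * Y) := by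
      induction k with
      | zero => simp
      | succ k ih => rw [pow_succ, ih, pow_succ (Y * X)]; simp only [mul_assoc]
    rw [h, trace_mul_comm, pow_succ, mul_assoc]

/-- Golden's trace inequalities, proved by a joint induction: the bound for `W` at exponent `k` gives the
bound for products `P * Q` at exponent `k + 1`, and the bound for products, applied to `Wᵀ * W` and
`W * Wᵀ`, gives back the bound for `W` at exponent `k + 1`. -/
lemma trace_pow_two_pow_le (k : ℕ) :
    (∀ W : Matrix ι ι ℝ, (W ^ 2 ^ (k + 1)).trace ≤ ((W * Wᵀ) ^ 2 ^ k).trace) ∧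
    (∀ P Q : Matrix ι ι ℝ, Pᵀ = P → Qᵀ = Q →
      ((P * Q) ^ 2 ^ k).trace ≤ (P ^ 2 ^ k * Q ^ 2 ^ k).trace) := by
  induction k with
  | zero =>
    refine ⟨fun W => ?_, fun P Q _ _ => by simp⟩
    have := trace_mul_le_half W W
    simp only [zero_add, pow_one, pow_zero, pow_two]
    linarith
  | succ k ih =>
    obtain ⟨ihW, ihPQ⟩ := ih
    have key : ∀ P Q : Matrix ι ι ℝ, Pᵀ = P → Qᵀ = Q →
        ((P * Q) ^ 2 ^ (k + 1)).trace ≤ (P ^ 2 ^ (k + 1) * Q ^ 2 ^ (k + 1)).trace := by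
      intro P Q hP hQ
      calc ((P * Q) ^ 2 ^ (k + 1)).trace ≤ ((P * Q * (P * Q)ᵀ) ^ 2 ^ k).trace := ihW _
        _ = ((P ^ 2 * Q ^ 2) ^ 2 ^ k).trace := by
          rw [transpose_mul, hP, hQ, show P * Q * (Q * P) = P * (Q ^ 2 * P) by
            simp only [pow_two, mul_assoc], trace_mul_pow_comm,
            show Q ^ 2 * P * P = Q ^ 2 * P ^ 2 by simp only [pow_two, mul_assoc],
            trace_mul_pow_comm]
        _ ≤ ((P ^ 2) ^ 2 ^ k * (Q ^ 2) ^ 2 ^ k).trace :=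
          ihPQ _ _ (by rw [transpose_pow, hP]) (by rw [transpose_pow, hQ])
        _ = _ := by rw [← pow_mul, ← pow_mul, ← pow_succ']
    refine ⟨fun W => ?_, key⟩
    have hP : (Wᵀ * W)ᵀ = Wᵀ * W := by simp
    have hQ : (W * Wᵀ)ᵀ = W * Wᵀ := by simp
    have hhalf := trace_mul_le_half ((Wᵀ * W) ^ 2 ^ k) ((W * Wᵀ) ^ 2 ^ k)
    rw [transpose_pow, transpose_pow, hP, hQ, ← pow_add, ← pow_add, ← two_mul, ← pow_succ',
      trace_mul_pow_comm Wᵀ W] at hhalf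
    calc (W ^ 2 ^ (k + 1 + 1)).trace = ((W ^ 2) ^ 2 ^ (k + 1)).trace := by
          rw [← pow_mul, ← pow_succ']
      _ ≤ ((W ^ 2 * (W ^ 2)ᵀ) ^ 2 ^ k).trace := ihW _
      _ = ((Wᵀ * W * (W * Wᵀ)) ^ 2 ^ k).trace := by
          rw [show W ^ 2 * (W ^ 2)ᵀ = W * (W * Wᵀ * Wᵀ) by
            simp only [pow_two, transpose_mul, mul_assoc], trace_mul_pow_comm,
            show W * Wᵀ * Wᵀ * W = W * Wᵀ * (Wᵀ * W) by simp only [mul_assoc],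
            trace_mul_pow_comm]
      _ ≤ ((Wᵀ * W) ^ 2 ^ k * (W * Wᵀ) ^ 2 ^ k).trace := ihPQ _ _ hP hQ
      _ ≤ _ := by linarith

end Trace

/-! ### The Lie product formula and the Golden–Thompson inequality -/

lemma norm_pow_sub_pow_le {𝔸 : Type*} [NormedRing 𝔸] [NormOneClass 𝔸] (x y : 𝔸) {R : ℝ}
    (hx : ‖x‖ ≤ R) (hy : ‖y‖ ≤ R) (N : ℕ) :
    ‖x ^ (N + 1) - y ^ (N + 1)‖ ≤ (N + 1) * R ^ N * ‖x - y‖ := by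
  have hR : 0 ≤ R := (norm_nonneg x).trans hx
  induction N with
  | zero => simp
  | succ N ih =>
    have e : x ^ (N + 1 + 1) - y ^ (N + 1 + 1)
        = x * (x ^ (N + 1) - y ^ (N + 1)) + (x - y) * y ^ (N + 1) := by
      rw [pow_succ' x (N + 1), pow_succ' y (N + 1)]; noncomm_ring
    rw [e]
    calc _ ≤ ‖x‖ * ‖x ^ (N + 1) - y ^ (N + 1)‖ + ‖x - y‖ * ‖y ^ (N + 1)‖ :=
          (norm_add_le _ _).trans (add_le_add (norm_mul_le _ _) (norm_mul_le _ _))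
      _ ≤ R * ((N + 1) * R ^ N * ‖x - y‖) + ‖x - y‖ * R ^ (N + 1) := by
          gcongr
          exact (norm_pow_le _ _).trans (pow_le_pow_left₀ (norm_nonneg _) hy _)
      _ = _ := by push_cast; ring

lemma norm_exp_le_exp_norm {𝔸 : Type*} [NormedRing 𝔸] [NormedAlgebra ℝ 𝔸] [NormOneClass 𝔸]
    [CompleteSpace 𝔸] (x : 𝔸) : ‖exp x‖ ≤ Real.exp ‖x‖ := by
  rw [exp_eq_tsum ℝ, Real.exp_eq_exp_ℝ, exp_eq_tsum_div]
  refine tsum_of_norm_bounded (expSeries_div_summable ‖x‖).hasSum fun k => ?_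
  rw [norm_smul, norm_inv, Real.norm_natCast, div_eq_inv_mul]
  gcongr
  exact norm_pow_le _ _

/-- The **Lie product formula**. -/
lemma tendsto_exp_mul_exp_pow {𝔸 : Type*} [NormedRing 𝔸] [NormedAlgebra ℝ 𝔸] [NormOneClass 𝔸]
    [CompleteSpace 𝔸] (a b : 𝔸) :
    Tendsto (fun N : ℕ => (exp ((N + 1 : ℝ)⁻¹ • a) * exp ((N + 1 : ℝ)⁻¹ • b)) ^ (N + 1)) atTop
      (𝓝 (exp (a + b))) := by
  set r : ℕ → ℝ := fun N => (N + 1 : ℝ)⁻¹ with hr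
  have hr0 : Tendsto r atTop (𝓝 0) := by
    simpa [hr, one_div] using tendsto_one_div_add_atTop_nhds_zero_nat (𝕜 := ℝ)
  -- The two factorizations agree to first order at `0`, so `f` vanishes to second order there.
  set f : ℝ → 𝔸 := fun t => exp (t • a) * exp (t • b) - exp (t • (a + b)) with hf
  have hderiv : HasDerivAt f 0 0 := by
    have h1 := hasDerivAt_exp_smul_const (𝕂 := ℝ) a 0
    have h2 := hasDerivAt_exp_smul_const (𝕂 := ℝ) b 0
    have h3 := hasDerivAt_exp_smul_const (𝕂 := ℝ) (a + b) 0
    exact ((h1.mul h2).sub h3).congr_deriv (by simp)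
  have hslope : Tendsto (fun N => (r N)⁻¹ * ‖f (r N)‖) atTop (𝓝 0) := by
    have h := hderiv.tendsto_slope_zero.norm
    have hr' : Tendsto r atTop (𝓝[≠] 0) := by
      refine tendsto_nhdsWithin_iff.2 ⟨hr0, Eventually.of_forall fun N => ?_⟩
      simp only [hr, Set.mem_compl_iff, Set.mem_singleton_iff]; positivity
    have h' := h.comp hr'
    have hf0 : f 0 = 0 := by simp [hf]
    simp only [norm_zero] at h'
    refine h'.congr fun N => ?_
    simp only [Function.comp, zero_add, hf0, sub_zero, norm_smul, norm_inv]
    rw [Real.norm_of_nonneg]; simp only [hr]; positivity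
  have hbound : ∀ N : ℕ,
      ‖(exp (r N • a) * exp (r N • b)) ^ (N + 1) - exp (a + b)‖
        ≤ Real.exp (‖a‖ + ‖b‖) * ((r N)⁻¹ * ‖f (r N)‖) := by
    intro N
    have hrN : 0 < r N := by simp only [hr]; positivity
    have hrmul : (N + 1 : ℝ) * r N = 1 := by simp only [hr]; field_simp
    have e : exp (a + b) = exp (r N • (a + b)) ^ (N + 1) := by
      let : NormedAlgebra ℚ 𝔸 := .restrictScalars ℚ ℝ 𝔸
      rw [← NormedSpace.exp_nsmul, ← Nat.cast_smul_eq_nsmul ℝ, smul_smul]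
      push_cast
      rw [hrmul, one_smul]
    have hn : ∀ c : 𝔸, ‖r N • c‖ = r N * ‖c‖ := fun c => by
      rw [norm_smul, Real.norm_of_nonneg hrN.le]
    have hR1 : ‖exp (r N • a) * exp (r N • b)‖ ≤ Real.exp (r N * (‖a‖ + ‖b‖)) := by
      rw [mul_add, Real.exp_add]
      refine (norm_mul_le _ _).trans ?_
      gcongr
      · exact (norm_exp_le_exp_norm _).trans_eq (by rw [hn])
      · exact (norm_exp_le_exp_norm _).trans_eq (by rw [hn])
    have hR2 : ‖exp (r N • (a + b))‖ ≤ Real.exp (r N * (‖a‖ + ‖b‖)) := by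
      refine (norm_exp_le_exp_norm _).trans ?_
      rw [hn]; gcongr; exact norm_add_le _ _
    rw [e]
    refine (norm_pow_sub_pow_le _ _ hR1 hR2 N).trans ?_
    have h1 : Real.exp (r N * (‖a‖ + ‖b‖)) ^ N ≤ Real.exp (‖a‖ + ‖b‖) := by
      rw [← Real.exp_nat_mul]
      have : (N : ℝ) * r N ≤ 1 := by nlinarith
      refine Real.exp_le_exp.2 ?_
      rw [← mul_assoc]
      exact mul_le_of_le_one_left (by positivity) this
    have h2 : (r N)⁻¹ = N + 1 := by simp [hr]
    rw [h2, hf]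
    calc _ ≤ (N + 1 : ℝ) * Real.exp (‖a‖ + ‖b‖) * ‖_‖ := by gcongr
      _ = _ := by ring
  rw [tendsto_iff_norm_sub_tendsto_zero]
  refine squeeze_zero (fun _ => norm_nonneg _) hbound ?_
  simpa using hslope.const_mul (Real.exp (‖a‖ + ‖b‖))

section Matrices

variable {ι : Type*} [Fintype ι] [DecidableEq ι]

/-- The **Golden–Thompson inequality** for real symmetric matrices. -/
theorem trace_exp_add_le {A B : Matrix ι ι ℝ} (hA : Aᵀ = A) (hB : Bᵀ = B) :
    (exp (A + B)).trace ≤ (exp A * exp B).trace := by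
  rcases isEmpty_or_nonempty ι with _ | _
  · simp [trace]
  -- Any complete algebra norm will do for the limit: the topology on matrices is the same.
  have hlim : Tendsto (fun N : ℕ =>
      (exp ((N + 1 : ℝ)⁻¹ • A) * exp ((N + 1 : ℝ)⁻¹ • B)) ^ (N + 1)) atTop
      (𝓝 (exp (A + B))) := by
    let : NormedRing (Matrix ι ι ℝ) := Matrix.linftyOpNormedRing
    let : NormedAlgebra ℝ (Matrix ι ι ℝ) := Matrix.linftyOpNormedAlgebra
    have : NormOneClass (Matrix ι ι ℝ) := Matrix.linfty_opNormOneClass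
    exact tendsto_exp_mul_exp_pow A B
  -- The trace inequality is available for exponents `2 ^ k`, so pass to that subsequence.
  have hsub : Tendsto (fun k : ℕ => 2 ^ k - 1) atTop atTop :=
    tendsto_atTop_mono (fun k => Nat.le_sub_one_of_lt Nat.lt_two_pow_self) tendsto_id
  have hcont : Continuous fun X : Matrix ι ι ℝ => X.trace := continuous_id.matrix_trace
  refine le_of_tendsto ((hcont.tendsto _).comp (hlim.comp hsub)) (Eventually.of_forall fun k => ?_)
  have hk : 2 ^ k - 1 + 1 = 2 ^ k := Nat.sub_add_cancel Nat.one_le_two_pow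
  have hc : ((2 ^ k - 1 : ℕ) : ℝ) + 1 = (2 ^ k : ℕ) := by exact_mod_cast hk
  have hpow : ∀ C : Matrix ι ι ℝ, exp (((2 ^ k : ℕ) : ℝ)⁻¹ • C) ^ 2 ^ k = exp C := by
    intro C
    rw [← Matrix.exp_nsmul, ← Nat.cast_smul_eq_nsmul ℝ, smul_smul, mul_inv_cancel₀ (by positivity),
      one_smul]
  simp only [Function.comp, hk, hc]
  refine ((trace_pow_two_pow_le k).2 _ _ ?_ ?_).trans_eq (by rw [hpow, hpow])
  · rw [← exp_transpose, transpose_smul, hA]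
  · rw [← exp_transpose, transpose_smul, hB]

/-! ### Quadratic forms and eigenvalues of real symmetric matrices -/

omit [DecidableEq ι] in
/-- Schur's test: the quadratic form of a symmetric matrix is bounded by its maximal absolute row sum. -/
lemma abs_dotProduct_mulVec_le {S : Matrix ι ι ℝ} (hS : Sᵀ = S) {R : ℝ}
    (hR : ∀ i, ∑ j, |S i j| ≤ R) (w : ι → ℝ) : |w ⬝ᵥ S *ᵥ w| ≤ R * (w ⬝ᵥ w) := by
  have hsymm : ∀ i j, S j i = S i j := fun i j => congrFun (congrFun hS i) j
  have h1 : |w ⬝ᵥ S *ᵥ w| ≤ ∑ i, ∑ j, |S i j| * ((w i ^ 2 + w j ^ 2) / 2) := by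
    simp only [dotProduct, mulVec, Finset.mul_sum]
    refine (Finset.abs_sum_le_sum_abs _ _).trans (Finset.sum_le_sum fun i _ => ?_)
    refine (Finset.abs_sum_le_sum_abs _ _).trans (Finset.sum_le_sum fun j _ => ?_)
    rw [show w i * (S i j * w j) = S i j * (w i * w j) by ring, abs_mul]
    gcongr
    rw [abs_le]
    constructor <;> nlinarith [sq_nonneg (w i + w j), sq_nonneg (w i - w j)]
  have h2 : ∑ i, ∑ j, |S i j| * ((w i ^ 2 + w j ^ 2) / 2) = ∑ i, (∑ j, |S i j|) * w i ^ 2 := by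
    have h3 : ∑ i, ∑ j, |S i j| * (w j ^ 2 / 2) = ∑ i, ∑ j, |S i j| * (w i ^ 2 / 2) := by
      rw [Finset.sum_comm]
      exact Finset.sum_congr rfl fun i _ => Finset.sum_congr rfl fun j _ => by rw [hsymm]
    calc _ = ∑ i, ∑ j, |S i j| * (w i ^ 2 / 2) + ∑ i, ∑ j, |S i j| * (w j ^ 2 / 2) := by
          simp only [← Finset.sum_add_distrib]
          exact Finset.sum_congr rfl fun i _ => Finset.sum_congr rfl fun j _ => by ring
      _ = _ := by
          rw [h3, ← Finset.sum_add_distrib]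
          refine Finset.sum_congr rfl fun i _ => ?_
          rw [← Finset.sum_mul]; ring
  refine h1.trans (h2.trans_le ?_)
  rw [dotProduct, Finset.mul_sum]
  refine Finset.sum_le_sum fun i _ => ?_
  rw [← pow_two]
  exact mul_le_mul_of_nonneg_right (hR i) (sq_nonneg _)

/-- `U` is orthogonal and diagonalizes `S`, with diagonal entries `d`. The transposes are used, instead of
the star structure of the spectral theorem, because all matrices here are real. -/
structure IsDiagonalization (S U : Matrix ι ι ℝ) (d : ι → ℝ) : Prop where
  transpose_mul : Uᵀ * U = 1
  mul_transpose : U * Uᵀ = 1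
  eq : S = U * diagonal d * Uᵀ

lemma exists_isDiagonalization {S : Matrix ι ι ℝ} (hS : Sᵀ = S) :
    ∃ U d, IsDiagonalization S U d := by
  have hH : S.IsHermitian := by rw [IsHermitian, conjTranspose_eq_transpose_of_trivial, hS]
  have hst : star (hH.eigenvectorUnitary : Matrix ι ι ℝ)
      = (hH.eigenvectorUnitary : Matrix ι ι ℝ)ᵀ := by
    rw [star_eq_conjTranspose, conjTranspose_eq_transpose_of_trivial]
  refine ⟨hH.eigenvectorUnitary, hH.eigenvalues, ?_, ?_, ?_⟩
  · rw [← hst]; exact Unitary.coe_star_mul_self _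
  · rw [← hst]; exact Unitary.coe_mul_star_self _
  · have h := hH.spectral_theorem
    rw [Unitary.conjStarAlgAut_apply, hst] at h
    exact h

namespace IsDiagonalization

variable {S U : Matrix ι ι ℝ} {d : ι → ℝ}

lemma exp (h : IsDiagonalization S U d) :
    IsDiagonalization (NormedSpace.exp S) U (fun i => Real.exp (d i)) := by
  refine ⟨h.1, h.2, ?_⟩
  have hu : IsUnit U := IsUnit.of_mul_eq_one _ h.2
  have hinv : U⁻¹ = Uᵀ := inv_eq_right_inv h.2
  rw [h.3, ← hinv, exp_conj _ _ hu, exp_diagonal]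
  congr 3
  ext i
  rw [Pi.coe_exp, Real.exp_eq_exp_ℝ]

lemma trace_mul (h : IsDiagonalization S U d) (Q : Matrix ι ι ℝ) :
    (Q * S).trace = ∑ i, (Uᵀ * Q * U) i i * d i := by
  rw [h.3, ← mul_assoc, ← mul_assoc, trace_mul_comm, ← mul_assoc, ← mul_assoc]
  simp [trace, mul_diagonal]

lemma trace_eq (h : IsDiagonalization S U d) : S.trace = ∑ i, d i := by
  rw [h.3, trace_mul_comm, ← mul_assoc, h.1, one_mul, trace_diagonal]

lemma dotProduct_mulVec (h : IsDiagonalization S U d) (w : ι → ℝ) :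
    w ⬝ᵥ S *ᵥ w = ∑ i, d i * (Uᵀ *ᵥ w) i ^ 2 := by
  rw [h.3, ← mulVec_mulVec, ← mulVec_mulVec, Matrix.dotProduct_mulVec, ← mulVec_transpose]
  simp only [dotProduct, mulVec_diagonal]
  exact Finset.sum_congr rfl fun i _ => by ring

lemma dotProduct_self (h : IsDiagonalization S U d) (w : ι → ℝ) :
    ∑ i, (Uᵀ *ᵥ w) i ^ 2 = w ⬝ᵥ w := by
  have e : w ⬝ᵥ w = (Uᵀ *ᵥ w) ⬝ᵥ (Uᵀ *ᵥ w) := by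
    rw [Matrix.dotProduct_mulVec, vecMul_transpose, mulVec_mulVec, h.2, one_mulVec]
  rw [e]
  exact Finset.sum_congr rfl fun i _ => pow_two _

lemma exists_unit_vector (h : IsDiagonalization S U d) (i : ι) :
    ∃ w : ι → ℝ, w ⬝ᵥ w = 1 ∧ w ⬝ᵥ S *ᵥ w = d i := by
  have hw : Uᵀ *ᵥ (U *ᵥ Pi.single i 1) = Pi.single i 1 := by rw [mulVec_mulVec, h.1, one_mulVec]
  refine ⟨U *ᵥ Pi.single i 1, ?_, ?_⟩
  · rw [← h.dotProduct_self, hw]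
    simp [Pi.single_apply]
  · rw [h.dotProduct_mulVec, hw]
    simp [Pi.single_apply]

lemma abs_le {K : ℝ} (h : IsDiagonalization S U d)
    (hK : ∀ w, |w ⬝ᵥ S *ᵥ w| ≤ K * (w ⬝ᵥ w)) (i : ι) : |d i| ≤ K := by
  obtain ⟨w, hw, hd⟩ := h.exists_unit_vector i
  simpa [hw, hd] using hK w

end IsDiagonalization

/-- The trace of `exp Y` dominates the exponential of each Rayleigh quotient of `Y`. -/
lemma exp_le_trace_exp {Y : Matrix ι ι ℝ} (hY : Yᵀ = Y) {w : ι → ℝ} (hw : w ⬝ᵥ w = 1) :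
    Real.exp (w ⬝ᵥ Y *ᵥ w) ≤ (exp Y).trace := by
  obtain ⟨U, d, h⟩ := exists_isDiagonalization hY
  set β := w ⬝ᵥ Y *ᵥ w with hβ
  have hsum : ∑ i, (Uᵀ *ᵥ w) i ^ 2 = 1 := (h.dotProduct_self w).trans hw
  have hle : ∀ i, (Uᵀ *ᵥ w) i ^ 2 ≤ 1 := fun i => by
    rw [← hsum]
    exact Finset.single_le_sum (f := fun i => (Uᵀ *ᵥ w) i ^ 2) (fun _ _ => sq_nonneg _)
      (Finset.mem_univ i)
  -- `exp t ≥ 1 + t`, averaged over the eigenvalues with the squared coordinates of `w` as weights.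
  have hone : 1 ≤ ∑ i, Real.exp (d i - β) := by
    calc (1 : ℝ) = ∑ i, (d i - β + 1) * (Uᵀ *ᵥ w) i ^ 2 := by
          simp only [add_mul, sub_mul, Finset.sum_add_distrib, Finset.sum_sub_distrib,
            ← Finset.mul_sum, one_mul, hsum, ← h.dotProduct_mulVec, ← hβ]
          ring
      _ ≤ ∑ i, Real.exp (d i - β) := by
          refine Finset.sum_le_sum fun i _ => ?_
          calc _ ≤ Real.exp (d i - β) * (Uᵀ *ᵥ w) i ^ 2 :=
                mul_le_mul_of_nonneg_right (Real.add_one_le_exp _) (sq_nonneg _)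
            _ ≤ _ := mul_le_of_le_one_right (Real.exp_pos _).le (hle i)
  rw [h.exp.trace_eq]
  calc Real.exp β = Real.exp β * 1 := (mul_one _).symm
    _ ≤ Real.exp β * ∑ i, Real.exp (d i - β) := by gcongr
    _ = _ := by
      rw [Finset.mul_sum]
      exact Finset.sum_congr rfl fun i _ => by rw [← Real.exp_add]; ring_nf

/-- The spectral norm of a symmetric matrix is attained, up to sign, by its quadratic form. -/
lemma exists_lt_of_lt_normTwo {n : ℕ} {S : Matrix (Fin n) (Fin n) ℝ} (hS : Sᵀ = S) {a : ℝ}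
    (ha : 0 ≤ a) (h : a < normTwo S) :
    ∃ w : Fin n → ℝ, w ⬝ᵥ w = 1 ∧ (a < w ⬝ᵥ S *ᵥ w ∨ a < w ⬝ᵥ (-S) *ᵥ w) := by
  obtain ⟨U, d, hd⟩ := exists_isDiagonalization hS
  have hnorm : normTwo S ≤ ‖d‖ := by
    have hst : star U = Uᵀ := by
      rw [star_eq_conjTranspose, conjTranspose_eq_transpose_of_trivial]
    have hU : U ∈ unitary (Matrix (Fin n) (Fin n) ℝ) :=
      Unitary.mem_iff.2 ⟨by rw [hst, hd.1], by rw [hst, hd.2]⟩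
    have hU' : Uᵀ ∈ unitary (Matrix (Fin n) (Fin n) ℝ) := by
      rw [← hst]; exact Unitary.star_mem hU
    unfold normTwo
    open scoped Matrix.Norms.L2Operator in
    rw [hd.3, CStarRing.norm_mul_mem_unitary _ hU', CStarRing.norm_mem_unitary_mul _ hU,
      l2_opNorm_diagonal]
  obtain ⟨i, hi⟩ : ∃ i, a < |d i| := by
    by_contra! hcon
    exact absurd ((pi_norm_le_iff_of_nonneg ha).2 hcon) (not_le.2 (h.trans_le hnorm))
  obtain ⟨w, hw, hwd⟩ := hd.exists_unit_vector i
  refine ⟨w, hw, ?_⟩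
  rw [neg_mulVec, dotProduct_neg, hwd]
  exact lt_abs.1 hi

/-! ### Compensated exponentials of Bernoulli summands -/

lemma exp_le_one_add_add_sq {u : ℝ} (hu : u ≤ 3 / 2) : Real.exp u ≤ 1 + u + u ^ 2 := by
  rcases le_or_gt 0 u with h0 | h0
  · have hv := Real.exp_bound' (x := u / 2) (by linarith) (by linarith) (n := 3) (by norm_num)
    norm_num [Finset.sum_range_succ, Nat.factorial] at hv
    rw [show u = u / 2 + u / 2 by ring, Real.exp_add]
    set v := u / 2 with hvdef
    have hv0 : 0 ≤ v := by positivity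
    have hv1 : v ≤ 3 / 4 := by rw [hvdef]; linarith
    calc Real.exp v * Real.exp v ≤ _ := mul_self_le_mul_self (Real.exp_pos v).le hv
      _ ≤ _ := by
        -- The square of the Taylor bound for `exp v`, minus `1 + 2 v + 4 v ^ 2`, is `-v ^ 2` times
        -- the factor below, which is positive on `[0, 3 / 4]`.
        have h2 : v ^ 2 ≤ 3 / 4 * v := by nlinarith
        have h3 : v ^ 3 ≤ 9 / 16 * v := by nlinarith
        have h4 : v ^ 4 ≤ 27 / 64 * v := by nlinarith
        have : 0 ≤ v ^ 2 * (2 - 13 / 9 * v - 25 / 36 * v ^ 2 - 2 / 9 * v ^ 3 - 4 / 81 * v ^ 4) :=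
          mul_nonneg (sq_nonneg _) (by linarith)
        nlinarith
  · rcases le_or_gt (-1) u with h1 | h1
    · have := Real.abs_exp_sub_one_sub_id_le (x := u) (by rw [abs_le]; constructor <;> linarith)
      linarith [(abs_le.1 this).2]
    · have := Real.exp_le_one_iff.2 h0.le
      nlinarith

/-- A Bernoulli(`p`) variable `b` satisfies `𝔼 exp ((b - p) u - p u²) ≤ 1` for `u ≤ 3 / 2`. -/
lemma bernoulli_exp_le_one {p u : ℝ} (hp : 0 ≤ p) (hu : u ≤ 3 / 2) :
    p * Real.exp ((1 - p) * u - p * u ^ 2) + (1 - p) * Real.exp (-p * u - p * u ^ 2) ≤ 1 := by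
  have e : p * Real.exp ((1 - p) * u - p * u ^ 2) + (1 - p) * Real.exp (-p * u - p * u ^ 2)
      = (p * (Real.exp u - 1) + 1) * Real.exp (-p * u - p * u ^ 2) := by
    rw [show (1 - p) * u - p * u ^ 2 = u + (-p * u - p * u ^ 2) by ring, Real.exp_add]; ring
  rw [e]
  calc _ ≤ Real.exp (p * (Real.exp u - 1)) * Real.exp (-p * u - p * u ^ 2) :=
        mul_le_mul_of_nonneg_right (Real.add_one_le_exp _) (Real.exp_pos _).le
    _ ≤ 1 := by
        rw [← Real.exp_add, Real.exp_le_one_iff]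
        nlinarith [mul_nonneg hp (sub_nonneg.2 (exp_le_one_add_add_sq hu))]

/-- The exponent `θ (b - q) A - θ² q A²` attached to a Bernoulli(`q`) variable with value `b`: the centred
summand `(b - q) A`, scaled by `θ` and compensated by a multiple of its variance bound `q A²`. The
two parts commute, so the expected exponential is governed by the scalar `bernoulli_exp_le_one`. -/
noncomputable def compensated (θ q b : ℝ) (A : Matrix ι ι ℝ) : Matrix ι ι ℝ :=
  (θ * (b - q)) • A - (θ ^ 2 * q) • (A * A)

omit [DecidableEq ι] in
lemma transpose_compensated {A : Matrix ι ι ℝ} (hA : Aᵀ = A) (θ q b : ℝ) :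
    (compensated θ q b A)ᵀ = compensated θ q b A := by
  simp [compensated, transpose_mul, hA]

lemma IsDiagonalization.compensated {A U : Matrix ι ι ℝ} {d : ι → ℝ}
    (h : IsDiagonalization A U d) (θ q b : ℝ) :
    IsDiagonalization (compensated θ q b A) U
      (fun i => (b - q) * (θ * d i) - q * (θ * d i) ^ 2) := by
  refine ⟨h.1, h.2, ?_⟩
  have hsq : A * A = U * diagonal (fun i => d i * d i) * Uᵀ := by
    rw [h.3, ← diagonal_mul_diagonal]
    calc _ = U * diagonal d * (Uᵀ * U) * diagonal d * Uᵀ := by simp only [mul_assoc]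
      _ = _ := by rw [h.1]; simp only [mul_assoc, one_mul]
  have hdiag : diagonal (fun i => (b - q) * (θ * d i) - q * (θ * d i) ^ 2)
      = (θ * (b - q)) • diagonal d - (θ ^ 2 * q) • diagonal (fun i => d i * d i) := by
    rw [← diagonal_smul, ← diagonal_smul, diagonal_sub]
    congr 1
    ext i
    simp only [Pi.smul_apply, smul_eq_mul]
    ring
  rw [SUGM.compensated, hsq, hdiag, Matrix.mul_sub, Matrix.sub_mul, Matrix.mul_smul, Matrix.mul_smul,
    Matrix.smul_mul, Matrix.smul_mul, ← h.3]

/-- Averaging over one compensated Bernoulli summand does not increase the trace exponential. -/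
lemma trace_exp_compensated_le {A Q : Matrix ι ι ℝ} (hA : Aᵀ = A) (hQ : Qᵀ = Q) {K θ q : ℝ}
    (hK : ∀ w, |w ⬝ᵥ A *ᵥ w| ≤ K * (w ⬝ᵥ w)) (hθ : 0 ≤ θ) (hθK : θ * K ≤ 3 / 2)
    (hq0 : 0 ≤ q) (hq1 : q ≤ 1) :
    q * (exp (Q + compensated θ q 1 A)).trace + (1 - q) * (exp (Q + compensated θ q 0 A)).trace
      ≤ (exp Q).trace := by
  obtain ⟨U, d, h⟩ := exists_isDiagonalization hA
  obtain ⟨W, μ, hW⟩ := exists_isDiagonalization hQ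
  -- In an eigenbasis of `A`, Golden–Thompson reduces the claim to scalars weighted by the diagonal
  -- entries of the positive matrix `exp Q`.
  set c : ι → ℝ := fun i => (Uᵀ * exp Q * U) i i with hc
  have hc0 : ∀ i, 0 ≤ c i := by
    intro i
    have e : Uᵀ * exp Q * U = (Uᵀ * W) * diagonal (fun k => Real.exp (μ k)) * (Uᵀ * W)ᵀ := by
      rw [hW.exp.3, transpose_mul, transpose_transpose]; simp only [mul_assoc]
    simp only [hc, e]
    rw [mul_apply]
    refine Finset.sum_nonneg fun k _ => ?_
    rw [mul_diagonal, transpose_apply, mul_right_comm]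
    exact mul_nonneg (mul_self_nonneg _) (Real.exp_pos _).le
  have htr : ∑ i, c i = (exp Q).trace := by
    rw [← mul_one (exp Q), ← h.2, ← mul_assoc, trace_mul_comm, ← mul_assoc]; rfl
  have hGT : ∀ b : ℝ, (exp (Q + compensated θ q b A)).trace
      ≤ ∑ i, c i * Real.exp ((b - q) * (θ * d i) - q * (θ * d i) ^ 2) := fun b =>
    (trace_exp_add_le hQ (transpose_compensated hA θ q b)).trans_eq
      ((h.compensated θ q b).exp.trace_mul _)
  calc _ ≤ q * ∑ i, c i * Real.exp ((1 - q) * (θ * d i) - q * (θ * d i) ^ 2)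
        + (1 - q) * ∑ i, c i * Real.exp ((0 - q) * (θ * d i) - q * (θ * d i) ^ 2) :=
        add_le_add (mul_le_mul_of_nonneg_left (hGT 1) hq0)
          (mul_le_mul_of_nonneg_left (hGT 0) (sub_nonneg.2 hq1))
    _ = ∑ i, c i * (q * Real.exp ((1 - q) * (θ * d i) - q * (θ * d i) ^ 2)
        + (1 - q) * Real.exp (-q * (θ * d i) - q * (θ * d i) ^ 2)) := by
        rw [Finset.mul_sum, Finset.mul_sum, ← Finset.sum_add_distrib]
        refine Finset.sum_congr rfl fun i _ => ?_
        rw [zero_sub]; ring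
    _ ≤ ∑ i, c i := by
        refine Finset.sum_le_sum fun i _ => mul_le_of_le_one_right (hc0 i) ?_
        refine bernoulli_exp_le_one hq0 (le_trans ?_ hθK)
        exact mul_le_mul_of_nonneg_left ((le_abs_self _).trans (h.abs_le hK i)) hθ
    _ = _ := htr

end Matrices

/-! ### A matrix Bernstein inequality for Bernoulli sums -/

section Bernstein

variable {ι : Type*} [Fintype ι] [DecidableEq ι] {σ : Type*} {Ω : Type*} [MeasurableSpace Ω]
  {P : Measure Ω} {x : σ → Ω → Bool} {q : σ → ℝ}
  {A : σ → Matrix ι ι ℝ} {K θ v : ℝ}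

/-- The value of a Boolean as the real number `0` or `1`. -/
def boolIndicator (b : Bool) : ℝ := if b then 1 else 0

lemma integral_boolIndicator {y : Ω → Bool} (hy : Measurable y) :
    ∫ ω, boolIndicator (y ω) ∂P = P.real {ω | y ω = true} := by
  have hm : MeasurableSet {ω | y ω = true} := hy (measurableSet_singleton true)
  rw [← integral_indicator_one hm]
  refine integral_congr_ae (Eventually.of_forall fun ω => ?_)
  by_cases h : y ω = true <;> simp [boolIndicator, h]

variable [IsProbabilityMeasure P]

lemma integrable_comp_of_finite {α : Type*} [Finite α] [MeasurableSpace α]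
    [MeasurableSingletonClass α] {X : Ω → α} (hX : Measurable X) (F : α → ℝ) :
    Integrable (fun ω => F (X ω)) P := by
  have := Measure.isProbabilityMeasure_map (μ := P) hX.aemeasurable
  exact (Integrable.of_finite (μ := P.map X) (f := F)).comp_measurable hX

/-- The law of total expectation for a Boolean variable `y` independent of `X`. -/
lemma integral_boolIndicator_mul {α : Type*} [Finite α] [MeasurableSpace α]
    [MeasurableSingletonClass α] {X : Ω → α} {y : Ω → Bool} (hX : Measurable X)
    (hy : Measurable y) (hind : IndepFun X y P) (F G : α → ℝ) :
    ∫ ω, (boolIndicator (y ω) * F (X ω) + (1 - boolIndicator (y ω)) * G (X ω)) ∂P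
      = P.real {ω | y ω = true} * ∫ ω, F (X ω) ∂P
        + (1 - P.real {ω | y ω = true}) * ∫ ω, G (X ω) ∂P := by
  have hI : Integrable (fun ω => boolIndicator (y ω)) P :=
    integrable_comp_of_finite hy boolIndicator
  have hprod : ∀ (c : Bool → ℝ) (F : α → ℝ), ∫ ω, c (y ω) * F (X ω) ∂P
      = (∫ ω, c (y ω) ∂P) * ∫ ω, F (X ω) ∂P := fun c F =>
    hind.symm.integral_fun_comp_mul_comp hy.aemeasurable hX.aemeasurable
      (measurable_of_finite c).aestronglyMeasurable (measurable_of_finite F).aestronglyMeasurable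
  have hint : ∀ (c : Bool → ℝ) (F : α → ℝ), Integrable (fun ω => c (y ω) * F (X ω)) P :=
    fun c F => integrable_comp_of_finite (hy.prodMk hX) fun z => c z.1 * F z.2
  rw [integral_add (hint boolIndicator F) (hint (fun b => 1 - boolIndicator b) G),
    hprod boolIndicator F, hprod (fun b => 1 - boolIndicator b) G, integral_sub (integrable_const _) hI,
    integral_boolIndicator hy]
  simp

/-- The compensated trace exponential of a sum of independent Bernoulli multiples of fixed matrices has
mean at most its value at `0`: the summands are averaged out one at a time. -/
lemma integral_trace_exp_sum_le (hx : ∀ s, Measurable (x s)) (hind : iIndepFun x P)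
    (hq : ∀ s, P.real {ω | x s ω = true} = q s) (hA : ∀ s, (A s)ᵀ = A s)
    (hK : ∀ s w, |w ⬝ᵥ A s *ᵥ w| ≤ K * (w ⬝ᵥ w)) (hθ : 0 ≤ θ) (hθK : θ * K ≤ 3 / 2)
    (S : Finset σ) :
    ∫ ω, (exp (∑ s ∈ S, compensated θ (q s) (boolIndicator (x s ω)) (A s))).trace ∂P
      ≤ Fintype.card ι := by
  classical
  induction S using Finset.induction_on with
  | empty => simp
  | insert a S ha ih =>
    set X : Ω → S → Bool := fun ω s => x s ω with hXdef
    have hX : Measurable X := measurable_pi_lambda _ fun s => hx s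
    set Z : (S → Bool) → Matrix ι ι ℝ :=
      fun y => ∑ s : S, compensated θ (q s) (boolIndicator (y s)) (A s) with hZ
    have hZX : ∀ ω, ∑ s ∈ S, compensated θ (q s) (boolIndicator (x s ω)) (A s) = Z (X ω) :=
      fun ω =>
      (Finset.sum_coe_sort S fun s => compensated θ (q s) (boolIndicator (x s ω)) (A s)).symm
    have hZt : ∀ y, (Z y)ᵀ = Z y := fun y => by
      rw [hZ, transpose_sum]
      exact Finset.sum_congr rfl fun s _ => transpose_compensated (hA s) _ _ _
    have hXa : IndepFun X (x a) P :=
      (hind.indepFun_finset S {a} (Finset.disjoint_singleton_right.2 ha) hx).comp measurable_id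
        (measurable_pi_apply (⟨a, Finset.mem_singleton_self a⟩ : ({a} : Finset σ)))
    set F : ℝ → (S → Bool) → ℝ := fun b y => (exp (Z y + compensated θ (q a) b (A a))).trace with hF
    have hsplit : ∀ ω,
        (exp (∑ s ∈ insert a S, compensated θ (q s) (boolIndicator (x s ω)) (A s))).trace
          = boolIndicator (x a ω) * F 1 (X ω) + (1 - boolIndicator (x a ω)) * F 0 (X ω) := by
      intro ω
      rw [Finset.sum_insert ha, hZX, add_comm]
      cases h : x a ω <;> simp [boolIndicator, hF]
    have hqa0 : 0 ≤ q a := hq a ▸ measureReal_nonneg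
    have hqa1 : q a ≤ 1 := hq a ▸ measureReal_le_one
    have hint : ∀ b, Integrable (fun ω => F b (X ω)) P := fun b => integrable_comp_of_finite hX _
    simp only [hsplit]
    rw [integral_boolIndicator_mul hX (hx a) hXa, hq a, ← integral_const_mul, ← integral_const_mul,
      ← integral_add ((hint 1).const_mul _) ((hint 0).const_mul _)]
    refine le_trans (integral_mono (((hint 1).const_mul _).add ((hint 0).const_mul _))
      (integrable_comp_of_finite hX fun y => (exp (Z y)).trace) fun ω => ?_) ?_
    · exact trace_exp_compensated_le (hA a) (hZt _) (hK a) hθ hθK hqa0 hqa1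
    · simpa only [hZX] using ih

/-- A one-sided matrix Bernstein inequality for Bernoulli sums, with free parameter `θ`. The variance
proxy `v` bounds the sum of the `q s • A s ^ 2` as a single matrix, not the sum of their norms. -/
lemma measureReal_exists_lt_le [Fintype σ] (hx : ∀ s, Measurable (x s)) (hind : iIndepFun x P)
    (hq : ∀ s, P.real {ω | x s ω = true} = q s) (hA : ∀ s, (A s)ᵀ = A s)
    (hK : ∀ s w, |w ⬝ᵥ A s *ᵥ w| ≤ K * (w ⬝ᵥ w))
    (hv : ∀ w, w ⬝ᵥ (∑ s, q s • (A s * A s)) *ᵥ w ≤ v * (w ⬝ᵥ w))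
    (hθ : 0 ≤ θ) (hθK : θ * K ≤ 3 / 2) (a : ℝ) :
    P.real {ω | ∃ w : ι → ℝ, w ⬝ᵥ w = 1 ∧
        a < w ⬝ᵥ (∑ s, (boolIndicator (x s ω) - q s) • A s) *ᵥ w}
      ≤ Fintype.card ι * Real.exp (-(θ * a - θ ^ 2 * v)) := by
  set Y : Ω → Matrix ι ι ℝ := fun ω =>
    ∑ s, compensated θ (q s) (boolIndicator (x s ω)) (A s) with hY
  have hYeq : ∀ ω, Y ω = θ • (∑ s, (boolIndicator (x s ω) - q s) • A s)
      - θ ^ 2 • ∑ s, q s • (A s * A s) := fun ω => by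
    simp only [hY, compensated, Finset.sum_sub_distrib, Finset.smul_sum, smul_smul]
  have hYt : ∀ ω, (Y ω)ᵀ = Y ω := fun ω => by
    rw [hY, transpose_sum]
    exact Finset.sum_congr rfl fun s _ => transpose_compensated (hA s) _ _ _
  have hX : Measurable fun ω s => x s ω := measurable_pi_lambda _ hx
  have hint : Integrable (fun ω => (exp (Y ω)).trace) P := by
    classical
    exact integrable_comp_of_finite hX fun y =>
      (exp (∑ s, compensated θ (q s) (boolIndicator (y s)) (A s))).trace
  have hnn : ∀ ω, 0 ≤ (exp (Y ω)).trace := fun ω => by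
    obtain ⟨U, d, h⟩ := exists_isDiagonalization (hYt ω)
    rw [h.exp.trace_eq]
    exact Finset.sum_nonneg fun i _ => (Real.exp_pos _).le
  have hmarkov := mul_meas_ge_le_integral_of_nonneg (Eventually.of_forall hnn) hint
    (Real.exp (θ * a - θ ^ 2 * v))
  have hsub : {ω | ∃ w : ι → ℝ, w ⬝ᵥ w = 1 ∧
        a < w ⬝ᵥ (∑ s, (boolIndicator (x s ω) - q s) • A s) *ᵥ w}
      ⊆ {ω | Real.exp (θ * a - θ ^ 2 * v) ≤ (exp (Y ω)).trace} := by
    rintro ω ⟨w, hw, haw⟩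
    refine (Real.exp_le_exp.2 ?_).trans (exp_le_trace_exp (hYt ω) hw)
    have h1 := hv w
    rw [hw, mul_one] at h1
    rw [hYeq, sub_mulVec, smul_mulVec, smul_mulVec, dotProduct_sub, dotProduct_smul,
      dotProduct_smul, smul_eq_mul, smul_eq_mul]
    gcongr
  have hmono := measureReal_mono (μ := P) hsub
  have htr := integral_trace_exp_sum_le (θ := θ) hx hind hq hA hK hθ hθK Finset.univ
  rw [Real.exp_neg, ← div_eq_mul_inv, le_div_iff₀ (Real.exp_pos _), mul_comm]
  exact (mul_le_mul_of_nonneg_left hmono (Real.exp_pos _).le).trans (hmarkov.trans htr)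

end Bernstein

/-! ### The weighted subgraph generated model -/

section Model

variable {T : Type*} {m : T → ℕ} (H : ∀ t, SimpleGraph (Fin (m t))) {n : ℕ}

open Classical in
/-- The adjacency matrix of the placed subgraph. -/
noncomputable def placedAdj (s : Placement m n) : Matrix (Fin n) (Fin n) ℝ :=
  (placedGraph H s).adjMatrix ℝ

lemma transpose_placedAdj (s : Placement m n) : (placedAdj H s)ᵀ = placedAdj H s := by
  classical exact SimpleGraph.transpose_adjMatrix _

lemma placedAdj_nonneg (s : Placement m n) (i j : Fin n) : 0 ≤ placedAdj H s i j := by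
  rw [placedAdj, SimpleGraph.adjMatrix_apply]
  split_ifs <;> norm_num

/-- The neighbours of a node in a placed subgraph lie among the nodes it is placed on. -/
lemma sum_placedAdj_le [Fintype T] (s : Placement m n) (i : Fin n) :
    ∑ j, placedAdj H s i j ≤ maxSize m := by
  classical
  calc ∑ j, placedAdj H s i j ≤ ∑ j, if j ∈ Finset.univ.map s.2 then (1 : ℝ) else 0 := by
        refine Finset.sum_le_sum fun j _ => ?_
        rw [placedAdj, SimpleGraph.adjMatrix_apply]
        split_ifs with h1 h2 h2
        · exact le_rfl
        · obtain ⟨-, b, -, -, hb⟩ := (SimpleGraph.map_adj _ _ _ _).1 h1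
          exact absurd (Finset.mem_map.2 ⟨b, Finset.mem_univ b, hb⟩) h2
        · exact zero_le_one
        · exact le_rfl
    _ = m s.1 := by
        rw [Finset.sum_ite_mem, Finset.univ_inter, Finset.sum_const, Finset.card_map,
          Finset.card_univ, Fintype.card_fin, nsmul_one]
    _ ≤ maxSize m := by exact_mod_cast Finset.le_sup (f := m) (Finset.mem_univ s.1)

lemma abs_dotProduct_placedAdj_le [Fintype T] (s : Placement m n) (w : Fin n → ℝ) :
    |w ⬝ᵥ placedAdj H s *ᵥ w| ≤ maxSize m * (w ⬝ᵥ w) := by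
  refine abs_dotProduct_mulVec_le (transpose_placedAdj H s) (fun i => ?_) w
  simp only [abs_of_nonneg (placedAdj_nonneg H s i _)]
  exact sum_placedAdj_le H s i

lemma sum_abs_le_normInf (B : Matrix (Fin n) (Fin n) ℝ) (i : Fin n) :
    ∑ j, |B i j| ≤ normInf B := by
  unfold normInf
  rw [linfty_opNorm_def]
  have h := Finset.le_sup (f := fun i => ∑ j, ‖B i j‖₊) (Finset.mem_univ i)
  calc ∑ j, |B i j| = ((∑ j, ‖B i j‖₊ : NNReal) : ℝ) := by simp
    _ ≤ _ := by exact_mod_cast h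

variable [Fintype T] {Ω : Type*}

lemma Aw_eq_sum (x : Placement m n → Ω → Bool) (ω : Ω) :
    Aw H x ω = ∑ s, boolIndicator (x s ω) • placedAdj H s := by
  ext i j
  rw [Aw, map_apply, weightedAdj, of_apply, Finset.card_filter, Matrix.sum_apply]
  push_cast
  refine Finset.sum_congr rfl fun s _ => ?_
  rw [Matrix.smul_apply, placedAdj, SimpleGraph.adjMatrix_apply, boolIndicator]
  by_cases h1 : x s ω = true <;> by_cases h2 : (placedGraph H s).Adj i j <;> simp [h1, h2]

variable [MeasurableSpace Ω] {P : Measure Ω} [IsProbabilityMeasure P]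
  {p : Placement m n → unitInterval} {x : Placement m n → Ω → Bool}

lemma expect_Aw (hx : IsFormation P p x) :
    expect P (Aw H x) = ∑ s, (p s : ℝ) • placedAdj H s := by
  ext i j
  rw [expect, of_apply, Matrix.sum_apply]
  simp only [Aw_eq_sum, Matrix.sum_apply, Matrix.smul_apply, smul_eq_mul]
  rw [integral_finsetSum _ fun s _ =>
    (integrable_comp_of_finite (hx.measurable s) boolIndicator).mul_const _]
  refine Finset.sum_congr rfl fun s _ => ?_
  rw [integral_mul_const, integral_boolIndicator (hx.measurable s), hx.prob s]

lemma Aw_sub_expect (hx : IsFormation P p x) (ω : Ω) :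
    Aw H x ω - expect P (Aw H x) = ∑ s, (boolIndicator (x s ω) - p s) • placedAdj H s := by
  rw [Aw_eq_sum, expect_Aw H hx, ← Finset.sum_sub_distrib]
  exact Finset.sum_congr rfl fun s _ => (sub_smul _ _ _).symm

/-- The row sums of `A_s ^ 2` are at most `M` times those of `A_s`, so the variance proxy is at most
`M * Δ_w`. -/
lemma dotProduct_variance_le (hx : IsFormation P p x) (w : Fin n → ℝ) :
    w ⬝ᵥ (∑ s, (p s : ℝ) • (placedAdj H s * placedAdj H s)) *ᵥ w
      ≤ maxSize m * maxExpectedDegree H P x * (w ⬝ᵥ w) := by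
  refine (le_abs_self _).trans (abs_dotProduct_mulVec_le ?_ (fun i => ?_) w)
  · simp only [transpose_sum, transpose_smul, transpose_mul, transpose_placedAdj]
  · have hp : ∀ s, 0 ≤ (p s : ℝ) := fun s => (p s).2.1
    have hrow : ∑ k, ∑ s, (p s : ℝ) * placedAdj H s i k ≤ maxExpectedDegree H P x := by
      refine le_trans (Finset.sum_le_sum fun k _ => ?_)
        (sum_abs_le_normInf (expect P (Aw H x)) i)
      rw [expect_Aw H hx, Matrix.sum_apply]
      exact le_abs_self _
    calc ∑ j, |(∑ s, (p s : ℝ) • (placedAdj H s * placedAdj H s)) i j|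
        = ∑ j, ∑ s, (p s : ℝ) * ∑ k, placedAdj H s i k * placedAdj H s k j := by
          refine Finset.sum_congr rfl fun j _ => ?_
          rw [Matrix.sum_apply, abs_of_nonneg]
          · simp only [Matrix.smul_apply, smul_eq_mul, mul_apply]
          · refine Finset.sum_nonneg fun s _ => ?_
            rw [Matrix.smul_apply, smul_eq_mul, mul_apply]
            exact mul_nonneg (hp s) (Finset.sum_nonneg fun k _ =>
              mul_nonneg (placedAdj_nonneg H s i k) (placedAdj_nonneg H s k j))
      _ = ∑ s, (p s : ℝ) * ∑ k, placedAdj H s i k * ∑ j, placedAdj H s k j := by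
          rw [Finset.sum_comm]
          refine Finset.sum_congr rfl fun s _ => ?_
          rw [← Finset.mul_sum, Finset.sum_comm]
          simp only [Finset.mul_sum]
      _ ≤ ∑ s, (p s : ℝ) * ∑ k, placedAdj H s i k * maxSize m := by
          gcongr with s _ k _
          · exact hp s
          · exact placedAdj_nonneg H s i k
          · exact sum_placedAdj_le H s k
      _ = maxSize m * ∑ k, ∑ s, (p s : ℝ) * placedAdj H s i k := by
          rw [Finset.sum_comm]
          simp only [Finset.mul_sum]
          exact Finset.sum_congr rfl fun s _ => Finset.sum_congr rfl fun k _ => by ring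
      _ ≤ maxSize m * maxExpectedDegree H P x := by gcongr

lemma sum_smul_placedAdj_eq_zero (h : n = 0 ∨ maxSize m = 0) (c : Placement m n → ℝ) :
    ∑ s, c s • placedAdj H s = 0 := by
  refine Finset.sum_eq_zero fun s _ => ?_
  ext i j
  rcases h with rfl | h
  · exact i.elim0
  · have h1 := (Finset.single_le_sum (fun k _ => placedAdj_nonneg H s i k)
      (Finset.mem_univ j)).trans (sum_placedAdj_le H s i)
    rw [h, Nat.cast_zero] at h1
    rw [Matrix.smul_apply, h1.antisymm (placedAdj_nonneg H s i j), smul_zero, Matrix.zero_apply]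

end Model

end SUGM

open SUGM Matrix

theorem proposition1 {T : Type*} [Fintype T] (m : T → ℕ) (H : ∀ t, SimpleGraph (Fin (m t)))
    (n : ℕ) (p : SUGM.Placement m n → unitInterval)
    {Ω : Type*} [MeasurableSpace Ω] (P : Measure Ω) [IsProbabilityMeasure P]
    (x : SUGM.Placement m n → Ω → Bool) (hx : SUGM.IsFormation P p x)
    (ε : ℝ) (hε : 0 < ε)
    (hΔ : SUGM.maxExpectedDegree H P x > 4 / 9 * Real.log (2 * n / ε)) :
    P.real {ω | SUGM.normTwo (SUGM.Aw H x ω - SUGM.expect P (SUGM.Aw H x)) ≤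
        √(4 * (SUGM.maxSize m : ℝ) ^ 2 * SUGM.maxExpectedDegree H P x * Real.log (2 * n / ε))}
      ≥ 1 - ε := by
  -- For `1 ≤ ε` the claim is void; below that threshold the logarithm is positive unless `n = 0`.
  rcases le_or_gt 1 ε with hε1 | hε1
  · exact le_trans (by linarith) measureReal_nonneg
  simp only [Aw_sub_expect H hx]
  by_cases hdeg : n = 0 ∨ maxSize m = 0
  · have h0 : normTwo (0 : Matrix (Fin n) (Fin n) ℝ) = 0 := by
      unfold normTwo
      open scoped Matrix.Norms.L2Operator in exact norm_zero
    simp only [sum_smul_placedAdj_eq_zero H hdeg, h0, Real.sqrt_nonneg, Set.ofPred_true,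
      probReal_univ]
    linarith
  push Not at hdeg
  set Δ := maxExpectedDegree H P x
  set L := Real.log (2 * n / ε) with hLdef
  set M := (maxSize m : ℝ) with hMdef
  have hn : (1 : ℝ) ≤ n := by exact_mod_cast Nat.one_le_iff_ne_zero.2 hdeg.1
  have hM : 1 ≤ M := by
    rw [hMdef]; exact_mod_cast Nat.one_le_iff_ne_zero.2 hdeg.2
  have hL : 0 < L := Real.log_pos (by rw [lt_div_iff₀ hε]; linarith)
  have hΔ0 : 0 < Δ := by linarith
  -- The parameter is `θ = r / M` with `r = √(L / Δ)`. The hypothesis on `Δ` says `r < 3 / 2`, as the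
  -- exponential bound needs, and then `θ a - θ² M Δ = 2 L - L / M ≥ L`.
  set r := √(L / Δ) with hr
  have hr0 : 0 ≤ r := Real.sqrt_nonneg _
  have hr2 : r ^ 2 * Δ = L := by
    rw [hr, Real.sq_sqrt (by positivity), div_mul_cancel₀ _ hΔ0.ne']
  have hr32 : r ≤ 3 / 2 := by
    rw [hr, Real.sqrt_le_left (by norm_num), div_le_iff₀ hΔ0]; linarith
  have ha : √(4 * M ^ 2 * Δ * L) = 2 * M * r * Δ := by
    rw [← hr2, show 4 * M ^ 2 * Δ * (r ^ 2 * Δ) = (2 * M * r * Δ) ^ 2 by ring,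
      Real.sqrt_sq (by positivity)]
  rw [ha]
  set a := 2 * M * r * Δ with hadef
  have ha0 : 0 ≤ a := by positivity
  have hθ : 0 ≤ r / M := by positivity
  have hθM : r / M * M ≤ 3 / 2 := by rwa [div_mul_cancel₀ _ (by positivity)]
  have hexp : (Fintype.card (Fin n) : ℝ) * Real.exp (-(r / M * a - (r / M) ^ 2 * (M * Δ)))
      ≤ ε / 2 := by
    have e : L ≤ r / M * a - (r / M) ^ 2 * (M * Δ) := by
      have h1 : r / M * a = 2 * L := by rw [hadef, ← hr2]; field_simp
      have h2 : (r / M) ^ 2 * (M * Δ) = L / M := by rw [← hr2]; field_simp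
      rw [h1, h2]
      linarith [div_le_self hL.le hM]
    calc _ ≤ (n : ℝ) * Real.exp (-L) := by
          rw [Fintype.card_fin]; gcongr
      _ = ε / 2 := by
          rw [Real.exp_neg, hLdef, Real.exp_log (by positivity)]
          field_simp
  have htail : ∀ A : Placement m n → Matrix (Fin n) (Fin n) ℝ, (∀ s, (A s)ᵀ = A s) →
      (∀ s w, |w ⬝ᵥ A s *ᵥ w| ≤ M * (w ⬝ᵥ w)) →
      (∀ s, A s * A s = placedAdj H s * placedAdj H s) →
      P.real {ω | ∃ w : Fin n → ℝ, w ⬝ᵥ w = 1 ∧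
        a < w ⬝ᵥ (∑ s, (boolIndicator (x s ω) - p s) • A s) *ᵥ w} ≤ ε / 2 := by
    intro A hA hAM hAsq
    refine (measureReal_exists_lt_le (v := M * Δ) hx.measurable hx.indep hx.prob hA hAM ?_ hθ hθM
      a).trans hexp
    simp only [hAsq]
    exact dotProduct_variance_le H hx
  have hpos := htail (placedAdj H) (transpose_placedAdj H) (abs_dotProduct_placedAdj_le H)
    fun _ => rfl
  have hneg := htail (fun s => -placedAdj H s)
    (fun s => by rw [transpose_neg, transpose_placedAdj])
    (fun s w => by
      rw [neg_mulVec, dotProduct_neg, abs_neg]; exact abs_dotProduct_placedAdj_le H s w)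
    fun s => neg_mul_neg _ _
  set good := {ω | normTwo (∑ s, (boolIndicator (x s ω) - p s) • placedAdj H s) ≤ a}
  have hcover : Set.univ ⊆ good ∪ ({ω | ∃ w : Fin n → ℝ, w ⬝ᵥ w = 1 ∧
        a < w ⬝ᵥ (∑ s, (boolIndicator (x s ω) - p s) • placedAdj H s) *ᵥ w}
      ∪ {ω | ∃ w : Fin n → ℝ, w ⬝ᵥ w = 1 ∧
        a < w ⬝ᵥ (∑ s, (boolIndicator (x s ω) - p s) • -placedAdj H s) *ᵥ w}) := by
    intro ω _
    by_cases hω : ω ∈ good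
    · exact Or.inl hω
    have hsymm : (∑ s, (boolIndicator (x s ω) - p s) • placedAdj H s)ᵀ
        = ∑ s, (boolIndicator (x s ω) - p s) • placedAdj H s := by
      simp only [transpose_sum, transpose_smul, transpose_placedAdj]
    obtain ⟨w, hw, h | h⟩ := exists_lt_of_lt_normTwo hsymm ha0 (not_le.1 hω)
    · exact Or.inr (Or.inl ⟨w, hw, h⟩)
    · refine Or.inr (Or.inr ⟨w, hw, ?_⟩)
      simpa only [smul_neg, Finset.sum_neg_distrib] using h
  have huniv := measureReal_mono (μ := P) hcover
  rw [probReal_univ] at huniv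
  have hunion := (huniv.trans (measureReal_union_le _ _)).trans
    (add_le_add le_rfl (measureReal_union_le _ _))
  linarith
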